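/- Let $n\ge 1$ and $N\ge n$. A \emph{conforming triangulation} in $\mathbb{R}^n$ is a collection $\mathcal{T}_0$ of closed $n$-simplices with pairwise disjoint interiors such that the intersection of any two of them is empty or spanned by a common subset of the vertices of both. It is \emph{$(N{+}1)$-colored} by a map $\mathfrak{c}$ from its vertices to $\{0,\dots,N\}$ if the colors of the vertices of each $T\in\mathcal{T}_0$ are distinct. \emph{Generation-based bisection.} Each vertex $v$ of $\mathcal{T}_0$ has the generation $\operatorname{gen}(v)=-\mathfrak{c}(v)$; the level $\ell(v)\in\mathbb{Z}$ and type $t(v)\in\{1,\dots,N\}$ of any vertex are determined by $\operatorname{gen}(v)=N(\ell(v)-1)+t(v)$. Let $T$ have vertices $v_0,\dots,v_n$ sorted by strictly decreasing generation. If $\ell(v_n)\ne\ell(v_{n-1})$, the bisection edge of $T$ is $[v_{n-1},v_n]$ and its midpoint $v'$ gets the generation $\operatorname{gen}(v_{n-1})+N$. Otherwise let $j=\min\{k:\ell(v_k)=\ell(v_n)\}$; the bisection edge is $[v_j,v_n]$ and its midpoint $v'$ gets the generation $\operatorname{gen}(v_n)+2N+1-t(v_j)$. The two children of $T$ arise by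 replacing one endpoint of the bisection edge by $v'$; all other vertices keep their generations. \emph{Maubach's bisection.} A tagged simplex is an array $[v_0,\dots,v_n]_\gamma$ of vertices with a tag $\gamma\in\{1,\dots,n\}$. Its bisection edge is $[v_0,v_\gamma]$ with midpoint $v'$, and its children are $[v_0,\dots,v_{\gamma-1},v',v_{\gamma+1},\dots,v_n]_{\gamma'}$ and $[v_1,\dots,v_\gamma,v',v_{\gamma+1},\dots,v_n]_{\gamma'}$, where $\gamma'=\gamma-1$ if $\gamma\ge2$ and $\gamma'=n$ if $\gamma=1$. A simplex $T\in\mathcal{T}_0$ with vertices sorted such that $\mathfrak{c}(v_0)<\dots<\mathfrak{c}(v_n)$ is initialized as $[v_n,v_0,\dots,v_{n-1}]_n$ if $\mathfrak{c}(v_n)=N$, and as $[v_0,\dots,v_n]_n$ otherwise. \textbf{Theorem (Equivalent refinements).} Let $(\mathcal{T}_0,\mathfrak{c})$ be an $(N{+}1)$-colored conforming triangulation in $\mathbb{R}^n$. Successive generation-based bisections of the simplices in $\mathcal{T}_0$ lead to the same simplices as successive Maubach bisections of the simplices in $\mathcal{T}_0$ with the above initialization. More precisely, for every $T\in\mathcal{T}_0$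 and every $k\ge0$, the set of simplices obtained from $T$ by $k$ successive bisections is the same for both routines, and so is the set of pairs consisting of such a simplex and its bisection edge; in particular, the sets of all simplices obtained from $\mathcal{T}_0$ by successive bisections coincide. -/

import Mathlib

noncomputable section

namespace ColoredBisection

/-- The Euclidean space `ℝⁿ`. -/
abbrev Pt (n : ℕ) : Type := EuclideanSpace ℝ (Fin n)

/-! ### Simplices, triangulations, colorings -/

/-- `T = [v 0, …, v k]` is the `k`-simplex with (affinely independent) vertices `v 0, …, v k`. -/
def IsSimplexWith {n k : ℕ} (v : Fin (k + 1) → Pt n) (T : Set (Pt n)) : Prop :=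
  AffineIndependent ℝ v ∧ T = convexHull ℝ (Set.range v)

/-- `S` is an `m`-subsimplex of the `n`-simplex `T`: it is spanned by `m + 1` of the vertices
of `T`. -/
def IsSubsimplex {n : ℕ} (m : ℕ) (S T : Set (Pt n)) : Prop :=
  ∃ v : Fin (n + 1) → Pt n, IsSimplexWith v T ∧
    ∃ W : Finset (Fin (n + 1)), W.card = m + 1 ∧ S = convexHull ℝ (v '' (W : Set (Fin (n + 1))))

/-- Conforming triangulations in `ℝⁿ`: collections of closed `n`-simplices with pairwise disjoint
interiors such that any two of them are disjoint or meet in an `m`-subsimplex of both. -/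
structure IsTriangulation (n : ℕ) (𝒯 : Set (Set (Pt n))) : Prop where
  simplex : ∀ T ∈ 𝒯, ∃ v : Fin (n + 1) → Pt n, IsSimplexWith v T
  disjoint_interior : ∀ T₁ ∈ 𝒯, ∀ T₂ ∈ 𝒯, T₁ ≠ T₂ → Disjoint (interior T₁) (interior T₂)
  conforming : ∀ T₁ ∈ 𝒯, ∀ T₂ ∈ 𝒯,
    T₁ ∩ T₂ = ∅ ∨ ∃ m ≤ n, IsSubsimplex m (T₁ ∩ T₂) T₁ ∧ IsSubsimplex m (T₁ ∩ T₂) T₂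

/-- `(𝒯, c)` is an `(N+1)`-colored triangulation in `ℝⁿ`, `N ≥ n`: the colors `0, …, N` of the
vertices of each simplex are distinct. The values of `c` at points that are not vertices of the
triangulation are never used. -/
structure IsColored (n N : ℕ) (𝒯 : Set (Set (Pt n))) (c : Pt n → Fin (N + 1)) : Prop where
  le : n ≤ N
  triangulation : IsTriangulation n 𝒯
  distinct : ∀ T ∈ 𝒯, ∀ v : Fin (n + 1) → Pt n, IsSimplexWith v T →
    Function.Injective fun i => c (v i)

/-! ### The generation-based bisection of `n`-simplices -/

/-- The level of a generation `g`: the integer `ℓ` with `g = N (ℓ - 1) + t`, `t ∈ {1, …, N}`. -/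
def level (N : ℕ) (g : ℤ) : ℤ := (g - 1) / N + 1

/-- The type of a generation `g`: the `t ∈ {1, …, N}` with `g = N (ℓ - 1) + t`, `ℓ` an integer. -/
def type (N : ℕ) (g : ℤ) : ℤ := (g - 1) % N + 1

/-- The equation `g = N (ℓ - 1) + t` with `t ∈ {1, …, N}` determines level and type. -/
theorem level_type_iff {N : ℕ} (hN : 1 ≤ N) (g l t : ℤ) :
    (g = N * (l - 1) + t ∧ 1 ≤ t ∧ t ≤ N) ↔ (l = level N g ∧ t = type N g) := by
  have hN' : (0 : ℤ) < N := by exact_mod_cast hN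
  have h1 := Int.emod_nonneg (g - 1) hN'.ne'
  have h2 := Int.emod_lt_of_pos (g - 1) hN'
  have h3 := Int.emod_add_mul_ediv (g - 1) N
  unfold level type
  constructor
  · rintro ⟨rfl, ha, hb⟩
    have e : (N : ℤ) * (l - 1) + t - 1 = (t - 1) + N * (l - 1) := by ring
    rw [e, Int.add_mul_ediv_left _ _ hN'.ne', Int.add_mul_emod_self_left,
      Int.ediv_eq_zero_of_lt (by omega) (by omega), Int.emod_eq_of_lt (by omega) (by omega)]
    constructor <;> ring
  · rintro ⟨rfl, rfl⟩
    refine ⟨?_, by omega, by omega⟩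
    rw [add_sub_cancel_right]
    linarith

/-- A vertex of color `κ`, whose generation is `-κ`, has level `0` if `κ < N`, and `-1` if
`κ = N`. -/
theorem level_initial {N : ℕ} (hN : 1 ≤ N) {κ : ℕ} (hκ : κ ≤ N) :
    level N (-(κ : ℤ)) = if κ < N then 0 else -1 := by
  split_ifs with h
  · exact ((level_type_iff hN (-(κ : ℤ)) 0 (N - κ)).1
      ⟨by ring, by omega, by omega⟩).1.symm
  · obtain rfl : κ = N := by omega
    exact ((level_type_iff hN (-(κ : ℤ)) (-1) κ).1
      ⟨by ring, by omega, by omega⟩).1.symm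

/-- An `n`-simplex given by its vertices, together with their generations, sorted by decreasing
generation. -/
structure GenSimplex (n : ℕ) where
  vert : Fin (n + 1) → Pt n
  gen : Fin (n + 1) → ℤ
  sorted : StrictAnti gen

namespace GenSimplex

variable {n : ℕ}

/-- The underlying simplex. -/
def body (S : GenSimplex n) : Set (Pt n) := convexHull ℝ (Set.range S.vert)

/-- The index `n - 1` of the second oldest vertex. -/
def penult (n : ℕ) : Fin (n + 1) := ⟨n - 1, by omega⟩

/-- `j = min {k : level (v k) = level (v n)}`. -/
def firstOld (N : ℕ) (S : GenSimplex n) : Fin (n + 1) :=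
  (Finset.univ.filter fun k : Fin (n + 1) =>
    level N (S.gen k) = level N (S.gen (Fin.last n))).min' ⟨Fin.last n, by simp⟩

/-- The index of that vertex of the bisection edge which is not the oldest vertex `v n`. -/
def edgeIdx (N : ℕ) (S : GenSimplex n) : Fin (n + 1) :=
  if level N (S.gen (Fin.last n)) ≠ level N (S.gen (penult n)) then penult n else S.firstOld N

/-- The bisection edge. -/
def edge (N : ℕ) (S : GenSimplex n) : Set (Pt n) :=
  segment ℝ (S.vert (S.edgeIdx N)) (S.vert (Fin.last n))

/-- The bisection vertex, the midpoint of the bisection edge. -/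
def newVert (N : ℕ) (S : GenSimplex n) : Pt n :=
  midpoint ℝ (S.vert (S.edgeIdx N)) (S.vert (Fin.last n))

/-- The generation of the bisection vertex. -/
def newGen (N : ℕ) (S : GenSimplex n) : ℤ :=
  if level N (S.gen (Fin.last n)) ≠ level N (S.gen (penult n)) then
    S.gen (penult n) + N
  else
    S.gen (Fin.last n) + 2 * N + 1 - type N (S.gen (S.firstOld N))

/-- `S'` is one of the two children of `S`: one of the two vertices of the bisection edge is
replaced by the bisection vertex, the other vertices keep their generations, and the vertices are
sorted by decreasing generation again. -/
def IsChild (N : ℕ) (S S' : GenSimplex n) : Prop :=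
  ∃ r : Fin (n + 1), (r = S.edgeIdx N ∨ r = Fin.last n) ∧
    Set.range (fun i => (S'.vert i, S'.gen i)) =
      insert (S.newVert N, S.newGen N) ((fun i => (S.vert i, S.gen i)) '' {i | i ≠ r})

/-- `S` is the initial simplex `T` with the generations `-c(v)` of its vertices `v`. -/
def IsInitial {N : ℕ} (c : Pt n → Fin (N + 1)) (T : Set (Pt n)) (S : GenSimplex n) : Prop :=
  IsSimplexWith S.vert T ∧ ∀ i, S.gen i = -((c (S.vert i) : ℕ) : ℤ)

/-- `Descendant c T k S`: `S` results from the initial simplex `T` by `k` successive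
bisections. -/
inductive Descendant {N : ℕ} (c : Pt n → Fin (N + 1)) (T : Set (Pt n)) :
    ℕ → GenSimplex n → Prop
  | initial {S : GenSimplex n} (h : IsInitial c T S) : Descendant c T 0 S
  | bisect {k : ℕ} {S S' : GenSimplex n} (h : Descendant c T k S) (h' : IsChild N S S') :
      Descendant c T (k + 1) S'

end GenSimplex

/-! ### Maubach's bisection of tagged `n`-simplices -/

/-- A sorted array of vertices with a tag `γ ∈ {1, …, n}`. -/
structure TaggedSimplex (n : ℕ) where
  vert : Fin (n + 1) → Pt n
  tag : Fin (n + 1)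
  tag_pos : 1 ≤ (tag : ℕ)

namespace TaggedSimplex

variable {n : ℕ}

/-- The underlying simplex. -/
def body (S : TaggedSimplex n) : Set (Pt n) := convexHull ℝ (Set.range S.vert)

/-- The bisection edge `[v 0, v γ]`. -/
def edge (S : TaggedSimplex n) : Set (Pt n) := segment ℝ (S.vert 0) (S.vert S.tag)

/-- The bisection vertex. -/
def newVert (S : TaggedSimplex n) : Pt n := midpoint ℝ (S.vert 0) (S.vert S.tag)

/-- The tag `γ - 1` if `γ ≥ 2`, and `n` otherwise. -/
def newTag (S : TaggedSimplex n) : Fin (n + 1) :=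
  if 2 ≤ (S.tag : ℕ) then ⟨(S.tag : ℕ) - 1, by omega⟩ else Fin.last n

theorem newTag_pos (S : TaggedSimplex n) : 1 ≤ (S.newTag : ℕ) := by
  have h1 := S.tag_pos
  have h2 := S.tag.isLt
  unfold newTag
  split_ifs
  · show 1 ≤ (S.tag : ℕ) - 1
    omega
  · show 1 ≤ n
    omega

/-- The child `[v 0, v 1, …, v (γ-1), v', v (γ+1), …, v n]`. -/
def child₁ (S : TaggedSimplex n) : TaggedSimplex n where
  vert i := if i = S.tag then S.newVert else S.vert i
  tag := S.newTag
  tag_pos := S.newTag_pos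

/-- The child `[v 1, v 2, …, v γ, v', v (γ+1), …, v n]`. -/
def child₂ (S : TaggedSimplex n) : TaggedSimplex n where
  vert i :=
    if h : i < S.tag then S.vert ⟨(i : ℕ) + 1, by omega⟩
    else if i = S.tag then S.newVert else S.vert i
  tag := S.newTag
  tag_pos := S.newTag_pos

/-- `S` is the tagged simplex assigned to the initial simplex `T`: with the vertices sorted such
that `c (v j) < c (v (j+1))`, it is `[v n, v 0, …, v (n-1)]` if `c (v n) = N`, and
`[v 0, …, v n]` otherwise, and the tag is `n`. -/
def IsInitial {N : ℕ} (c : Pt n → Fin (N + 1)) (T : Set (Pt n)) (S : TaggedSimplex n) : Prop :=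
  ∃ v : Fin (n + 1) → Pt n, IsSimplexWith v T ∧ StrictMono (fun i => c (v i)) ∧
    S.tag = Fin.last n ∧
    S.vert = if c (v (Fin.last n)) = Fin.last N then
        Fin.cons (v (Fin.last n)) (fun i : Fin n => v i.castSucc)
      else v

/-- `Descendant c T k S`: `S` results from the initial simplex `T` by `k` successive
bisections. -/
inductive Descendant {N : ℕ} (c : Pt n → Fin (N + 1)) (T : Set (Pt n)) :
    ℕ → TaggedSimplex n → Prop
  | initial {S : TaggedSimplex n} (h : IsInitial c T S) : Descendant c T 0 S
  | bisect₁ {k : ℕ} {S : TaggedSimplex n} (h : Descendant c T k S) :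
      Descendant c T (k + 1) S.child₁
  | bisect₂ {k : ℕ} {S : TaggedSimplex n} (h : Descendant c T k S) :
      Descendant c T (k + 1) S.child₂

end TaggedSimplex

/-! ### The simplices that the two routines produce -/

/-- The simplices that result from `T` by `k` successive generation-based bisections. -/
def genSimplices {n N : ℕ} (c : Pt n → Fin (N + 1)) (T : Set (Pt n)) (k : ℕ) :
    Set (Set (Pt n)) :=
  {B | ∃ S, GenSimplex.Descendant c T k S ∧ B = S.body}

/-- The simplices that result from `T` by `k` successive bisections of Maubach's routine. -/
def maubachSimplices {n N : ℕ} (c : Pt n → Fin (N + 1)) (T : Set (Pt n)) (k : ℕ) :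
    Set (Set (Pt n)) :=
  {B | ∃ S, TaggedSimplex.Descendant c T k S ∧ B = S.body}

/-- The pairs (simplex, bisection edge) after `k` successive generation-based bisections. -/
def genEdges {n N : ℕ} (c : Pt n → Fin (N + 1)) (T : Set (Pt n)) (k : ℕ) :
    Set (Set (Pt n) × Set (Pt n)) :=
  {p | ∃ S, GenSimplex.Descendant c T k S ∧ p = (S.body, S.edge N)}

/-- The pairs (simplex, bisection edge) after `k` successive bisections of Maubach's routine. -/
def maubachEdges {n N : ℕ} (c : Pt n → Fin (N + 1)) (T : Set (Pt n)) (k : ℕ) :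
    Set (Set (Pt n) × Set (Pt n)) :=
  {p | ∃ S, TaggedSimplex.Descendant c T k S ∧ p = (S.body, S.edge)}

/-- All simplices that result from the initial triangulation by successive generation-based
bisections. -/
def genTree {n N : ℕ} (c : Pt n → Fin (N + 1)) (𝒯 : Set (Set (Pt n))) : Set (Set (Pt n)) :=
  ⋃ T ∈ 𝒯, ⋃ k, genSimplices c T k

/-- All simplices that result from the initial triangulation by successive bisections of Maubach's
routine. -/
def maubachTree {n N : ℕ} (c : Pt n → Fin (N + 1)) (𝒯 : Set (Set (Pt n))) : Set (Set (Pt n)) :=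
  ⋃ T ∈ 𝒯, ⋃ k, maubachSimplices c T k

end ColoredBisection

end

namespace ColoredBisection

/-! ### Levels -/

/-! The generations, read along Maubach's array, always follow one of two patterns, and the tag is
visible in them. In the flat pattern `FlatGen`, the vertices `0, …, γ` share the lowest level and
decrease, so `γ` is the oldest vertex and `0` the youngest of its level. In the spiked pattern
`SpikedGen`, vertex `0` is alone below the level of `1, …, γ`, so `0` is the oldest and `γ` the
second oldest. The rule for the generation-based edge then selects the positions `0` and `γ` in
either pattern (`FlatGen.edge_data`, `SpikedGen.edge_data`).

The patterns are hereditary (`AdmissibleGen.child`). The bisection vertex gets the next level and is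
younger than all vertices after position `γ`, so it fits in at position `γ` once the tag drops to `γ
- 1`. At tag `1` the lower level is exhausted up to one vertex, which becomes the spike of a new
cycle with tag `n`. Initially, color `N` is the only color of level `-1`, so the rotation in the
initialization puts the spike first.

Hence matching simplices have matching children (`Matches.child`), and induction on the number of
bisections concludes. -/

theorem level_eq {N : ℕ} (hN : 1 ≤ N) {g m : ℤ} (h1 : N * m < g) (h2 : g ≤ N * m + N) :
    level N g = m + 1 :=
  ((level_type_iff hN g (m + 1) (g - N * m)).1 ⟨by ring, by omega, by omega⟩).1.symm

theorem type_eq {N : ℕ} (hN : 1 ≤ N) {g m : ℤ} (h1 : N * m < g) (h2 : g ≤ N * m + N) :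
    type N g = g - N * m :=
  ((level_type_iff hN g (m + 1) (g - N * m)).1 ⟨by ring, by omega, by omega⟩).2.symm

theorem level_le {N : ℕ} (hN : 1 ≤ N) {g m : ℤ} (h : g ≤ N * m) : level N g ≤ m := by
  have hN' : (0 : ℤ) < N := by exact_mod_cast hN
  have : (g - 1) / N < m := Int.ediv_lt_of_lt_mul hN' (by rw [mul_comm]; omega)
  unfold level
  omega

theorem lt_level {N : ℕ} (hN : 1 ≤ N) {g m : ℤ} (h : N * m < g) : m < level N g := by
  have hN' : (0 : ℤ) < N := by exact_mod_cast hN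
  have : m ≤ (g - 1) / N := (Int.le_ediv_iff_mul_le hN').2 (by rw [mul_comm]; omega)
  unfold level
  omega

/-! ### Generations along the array of a tagged simplex -/

/-- The vertices `0, …, γ` have the level with generations `b + 1, …, b + N`, the others the
next one; the generations decrease within each level. -/
structure FlatGen (N n γ : ℕ) (b : ℤ) (g : ℕ → ℤ) : Prop where
  old : ∀ i ≤ γ, b < g i ∧ g i ≤ b + N
  anti_old : ∀ i j, i < j → j ≤ γ → g j < g i
  young : ∀ i, γ < i → i ≤ n →
    b + N < g i ∧ g i ≤ b + 2 * N ∧ g i < g γ + 2 * N + 1 - (g 0 - b)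
  anti_young : ∀ i j, γ < i → i < j → j ≤ n → g j < g i

/-- The vertex `0` is older than the level with generations `b + 1, …, b + N`; the vertices
`1, …, γ` have this level, the others the next one; the generations decrease within each level. -/
structure SpikedGen (N n γ : ℕ) (b : ℤ) (g : ℕ → ℤ) : Prop where
  zero : g 0 ≤ b
  old : ∀ i, 1 ≤ i → i ≤ γ → b < g i ∧ g i ≤ b + N
  anti_old : ∀ i j, 1 ≤ i → i < j → j ≤ γ → g j < g i
  young : ∀ i, γ < i → i ≤ n → b + N < g i ∧ g i ≤ b + 2 * N ∧ g i < g γ + N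
  anti_young : ∀ i j, γ < i → i < j → j ≤ n → g j < g i

/-- The generations along the array of a tagged simplex with tag `γ` that arise in Maubach's
routine, where `x` is the generation of the bisection vertex. -/
def AdmissibleGen (N n γ : ℕ) (g : ℕ → ℤ) (x : ℤ) : Prop :=
  ∃ m : ℤ, (FlatGen N n γ (N * m) g ∧ x = g γ + 2 * N + 1 - (g 0 - N * m)) ∨
    (SpikedGen N n γ (N * m) g ∧ x = g γ + N)

/-- The tag following `γ`. -/
def nextTag (n γ : ℕ) : ℕ := if 2 ≤ γ then γ - 1 else n

/-- The generations of the first child. -/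
def childGen₁ (γ : ℕ) (g : ℕ → ℤ) (x : ℤ) (i : ℕ) : ℤ := if i = γ then x else g i

/-- The generations of the second child. -/
def childGen₂ (γ : ℕ) (g : ℕ → ℤ) (x : ℤ) (i : ℕ) : ℤ :=
  if i < γ then g (i + 1) else if i = γ then x else g i

theorem AdmissibleGen.ne {N n γ : ℕ} {g : ℕ → ℤ} {x : ℤ} (h : AdmissibleGen N n γ g x)
    {i j : ℕ} (hij : i < j) (hj : j ≤ n) : g i ≠ g j := by
  obtain ⟨m, ⟨h, -⟩ | ⟨h, -⟩⟩ := h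
  · have h1 := h.old i
    have h2 := h.anti_old i j hij
    have h3 := h.young j
    have h4 := h.anti_young i j
    omega
  · have h0 := h.zero
    have h1 := h.old i
    have h2 := h.anti_old i j
    have h3 := h.young j
    have h4 := h.anti_young i j
    have h5 := h.old j
    rcases Nat.eq_zero_or_pos i with rfl | hi <;> omega

theorem AdmissibleGen.injective {N n γ : ℕ} {g : ℕ → ℤ} {x : ℤ}
    (h : AdmissibleGen N n γ g x) : Function.Injective fun i : Fin (n + 1) => g i := by
  intro i j hij
  by_contra hne
  have hne' : (i : ℕ) ≠ j := fun e => hne (Fin.ext e)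
  rcases Nat.lt_or_gt_of_ne hne' with hlt | hlt
  · exact h.ne hlt (by omega) hij
  · exact h.ne hlt (by omega) hij.symm

/-! ### Inheritance of the two patterns by the children -/

/-- Since `b < g γ < g 0 ≤ b + N`, the new generation lies in the next level. The strict upper bound
on the young generations survives because `g γ < g (γ - 1)`: the next bisection vertex will be
younger still. -/
theorem FlatGen.child₁ {N n γ : ℕ} {b : ℤ} {g : ℕ → ℤ} (h : FlatGen N n γ b g) (hγ : 2 ≤ γ) :
    FlatGen N n (γ - 1) b (childGen₁ γ g (g γ + 2 * N + 1 - (g 0 - b))) := by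
  have hγ0 := h.old 0 (by omega)
  have hγ1 := h.old γ le_rfl
  have hγ2 := h.anti_old 0 γ (by omega) le_rfl
  have hγ3 := h.anti_old (γ - 1) γ (by omega) le_rfl
  refine ⟨fun i hi => ?_, fun i j hij hj => ?_, fun i hi hin => ?_, fun i j hi hij hj => ?_⟩ <;>
    simp only [childGen₁]
  · have := h.old i
    split_ifs <;> omega
  · have := h.anti_old i j
    split_ifs <;> omega
  · have := h.young i
    split_ifs <;> omega
  · have := h.anti_young i j
    have := h.young j
    split_ifs <;> omega

/-- Here `γ` remains the oldest vertex while `0` is dropped, and `g 1 < g 0` raises the generation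
of the next bisection vertex. -/
theorem FlatGen.child₂ {N n γ : ℕ} {b : ℤ} {g : ℕ → ℤ} (h : FlatGen N n γ b g) (hγ : 2 ≤ γ) :
    FlatGen N n (γ - 1) b (childGen₂ γ g (g γ + 2 * N + 1 - (g 0 - b))) := by
  have hγ0 := h.old 0 (by omega)
  have hγ1 := h.old γ le_rfl
  have hγ2 := h.anti_old 0 γ (by omega) le_rfl
  have hγ3 := h.anti_old 0 1 (by omega) (by omega)
  have e : γ - 1 + 1 = γ := by omega
  refine ⟨fun i hi => ?_, fun i j hij hj => ?_, fun i hi hin => ?_, fun i j hi hij hj => ?_⟩ <;>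
    simp only [childGen₂, e, zero_add]
  · have := h.old (i + 1)
    split_ifs <;> omega
  · have := h.anti_old (i + 1) (j + 1)
    split_ifs <;> omega
  · have := h.young i
    split_ifs <;> omega
  · have := h.anti_young i j
    have := h.young j
    split_ifs <;> omega

theorem SpikedGen.child₁ {N n γ : ℕ} {b : ℤ} {g : ℕ → ℤ} (h : SpikedGen N n γ b g)
    (hγ : 2 ≤ γ) : SpikedGen N n (γ - 1) b (childGen₁ γ g (g γ + N)) := by
  have hγ0 := h.zero
  have hγ1 := h.old γ (by omega) le_rfl
  have hγ3 := h.anti_old (γ - 1) γ (by omega) (by omega) le_rfl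
  refine ⟨?_, fun i hi hi' => ?_, fun i j hi hij hj => ?_, fun i hi hin => ?_,
    fun i j hi hij hj => ?_⟩ <;> simp only [childGen₁]
  · split_ifs <;> omega
  · have := h.old i
    split_ifs <;> omega
  · have := h.anti_old i j
    split_ifs <;> omega
  · have := h.young i
    split_ifs <;> omega
  · have := h.anti_young i j
    have := h.young j
    split_ifs <;> omega

/-- Dropping the spike leaves a flat array. The bounds for new vertices are compatible: `g 1 - b ≤
N` makes the flat value `g γ + 2 * N + 1 - (g 1 - b)` exceed `g γ + N`. -/
theorem SpikedGen.child₂ {N n γ : ℕ} {b : ℤ} {g : ℕ → ℤ} (h : SpikedGen N n γ b g)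
    (hγ : 2 ≤ γ) : FlatGen N n (γ - 1) b (childGen₂ γ g (g γ + N)) := by
  have hγ0 := h.old 1 le_rfl (by omega)
  have hγ1 := h.old γ (by omega) le_rfl
  have e : γ - 1 + 1 = γ := by omega
  refine ⟨fun i hi => ?_, fun i j hij hj => ?_, fun i hi hin => ?_, fun i j hi hij hj => ?_⟩ <;>
    simp only [childGen₂, e, zero_add]
  · have := h.old (i + 1)
    split_ifs <;> omega
  · have := h.anti_old (i + 1) (j + 1)
    split_ifs <;> omega
  · have := h.young i
    split_ifs <;> omega
  · have := h.anti_young i j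
    have := h.young j
    split_ifs <;> omega

/-- When the tag is `1`, both children start a new cycle. -/
theorem spikedGen_of_young {N n : ℕ} {b : ℤ} {g : ℕ → ℤ} (h0 : g 0 ≤ b + N)
    (h1 : ∀ i, 1 ≤ i → i ≤ n → b + N < g i ∧ g i ≤ b + 2 * N)
    (h2 : ∀ i j, 1 ≤ i → i < j → j ≤ n → g j < g i) : SpikedGen N n n (b + N) g where
  zero := h0
  old i hi hin := ⟨(h1 i hi hin).1, by linarith [(h1 i hi hin).2]⟩
  anti_old := h2
  young i hi hin := by omega
  anti_young i j hi hij hj := by omega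

/-- With tag `1`, each child keeps only one of the vertices `0` and `1`, and this becomes the spike.
All others, including the bisection vertex, are in the next level. -/
theorem AdmissibleGen.spiked_child {N n : ℕ} {g : ℕ → ℤ} {x : ℤ}
    (h : AdmissibleGen N n 1 g x) :
    ∃ m : ℤ, SpikedGen N n n (N * m) (childGen₁ 1 g x) ∧
      SpikedGen N n n (N * m) (childGen₂ 1 g x) := by
  obtain ⟨m, h⟩ := h
  -- These bounds hold in both patterns and are all that a new cycle needs.
  suffices hs : g 0 ≤ N * m + N ∧ g 1 ≤ N * m + N ∧ N * m + N < x ∧ x ≤ N * m + 2 * N ∧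
      (∀ i, 1 < i → i ≤ n → N * m + N < g i ∧ g i ≤ N * m + 2 * N ∧ g i < x) ∧
      ∀ i j, 1 < i → i < j → j ≤ n → g j < g i by
    obtain ⟨h0, h1, h2, h3, h4, h5⟩ := hs
    have e : (N : ℤ) * (m + 1) = N * m + N := by ring
    refine ⟨m + 1, ?_, ?_⟩ <;> rw [e] <;>
      refine spikedGen_of_young ?_ (fun i hi hin => ?_) fun i j hi hij hj => ?_ <;>
      simp only [childGen₁, childGen₂, zero_add]
    · simpa using h0
    · have := h4 i
      split_ifs <;> omega
    · have := h4 j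
      have := h5 i j
      split_ifs <;> omega
    · simpa using h1
    · have := h4 i
      split_ifs <;> omega
    · have := h4 j
      have := h5 i j
      split_ifs <;> omega
  rcases h with ⟨h, rfl⟩ | ⟨h, rfl⟩
  · have h0 := h.old 0 (by omega)
    have h1 := h.old 1 le_rfl
    have h2 := h.anti_old 0 1 (by omega) le_rfl
    exact ⟨h0.2, h1.2, by omega, by omega, fun i hi hin => h.young i hi hin, h.anti_young⟩
  · have h0 := h.zero
    have h1 := h.old 1 le_rfl le_rfl
    exact ⟨by omega, h1.2, by omega, by omega, fun i hi hin => h.young i hi hin, h.anti_young⟩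

theorem AdmissibleGen.child {N n γ : ℕ} {g : ℕ → ℤ} {x : ℤ} (h : AdmissibleGen N n γ g x)
    (hγ : 1 ≤ γ) :
    (∃ y, AdmissibleGen N n (nextTag n γ) (childGen₁ γ g x) y) ∧
      ∃ y, AdmissibleGen N n (nextTag n γ) (childGen₂ γ g x) y := by
  unfold nextTag
  split_ifs with hγ2
  · obtain ⟨m, ⟨h, rfl⟩ | ⟨h, rfl⟩⟩ := h
    · exact ⟨⟨_, m, .inl ⟨h.child₁ hγ2, rfl⟩⟩, ⟨_, m, .inl ⟨h.child₂ hγ2, rfl⟩⟩⟩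
    · exact ⟨⟨_, m, .inr ⟨h.child₁ hγ2, rfl⟩⟩, ⟨_, m, .inl ⟨h.child₂ hγ2, rfl⟩⟩⟩
  · obtain rfl : γ = 1 := by omega
    obtain ⟨m, h1, h2⟩ := h.spiked_child
    exact ⟨⟨_, m, .inr ⟨h1, rfl⟩⟩, ⟨_, m, .inr ⟨h2, rfl⟩⟩⟩

/-! ### Matching simplices of the two routines -/

/-- `S` consists of the vertices `v i` with the generations `g i`. -/
def GenSimplex.Lists {n : ℕ} (S : GenSimplex n) (v : Fin (n + 1) → Pt n) (g : ℕ → ℤ)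
    (σ : Equiv.Perm (Fin (n + 1))) : Prop :=
  ∀ i, S.vert i = v (σ i) ∧ S.gen i = g (σ i)

theorem GenSimplex.exists_lists {n : ℕ} (v : Fin (n + 1) → Pt n) (g : ℕ → ℤ)
    (hg : Function.Injective fun i : Fin (n + 1) => g i) :
    ∃ (S : GenSimplex n) (σ : Equiv.Perm (Fin (n + 1))), S.Lists v g σ := by
  set σ := Tuple.sort fun i : Fin (n + 1) => -g i
  have hmono : Monotone fun i => -g (σ i) := Tuple.monotone_sort fun i : Fin (n + 1) => -g i
  have hinj : Function.Injective fun i => -g (σ i) := fun i j hij =>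
    σ.injective (hg (neg_injective hij))
  refine ⟨⟨fun i => v (σ i), fun i => g (σ i), fun i j hij => ?_⟩, σ, fun i => ⟨rfl, rfl⟩⟩
  exact neg_lt_neg_iff.1 (hmono.strictMono_of_injective hinj hij)

theorem GenSimplex.Lists.range_eq {n : ℕ} {S : GenSimplex n} {v : Fin (n + 1) → Pt n}
    {g : ℕ → ℤ} {σ : Equiv.Perm (Fin (n + 1))} (h : S.Lists v g σ) :
    Set.range (fun i => (S.vert i, S.gen i)) = Set.range fun i : Fin (n + 1) => (v i, g i) := by
  rw [← σ.surjective.range_comp fun i : Fin (n + 1) => (v i, g i)]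
  exact congrArg Set.range (funext fun i => Prod.ext (h i).1 (h i).2)

/-- `IsChild` prescribes only a set of pairs. Generations in a `GenSimplex` are distinct, so
matching pairs gives an injective, hence bijective, map of indices. -/
theorem GenSimplex.lists_of_range_eq {n : ℕ} {S : GenSimplex n} {v : Fin (n + 1) → Pt n}
    {g : ℕ → ℤ} (h : Set.range (fun i => (S.vert i, S.gen i)) =
      Set.range fun i : Fin (n + 1) => (v i, g i)) :
    ∃ σ, S.Lists v g σ := by
  have h1 : ∀ i, ∃ k : Fin (n + 1), (v k, g k) = (S.vert i, S.gen i) := fun i => by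
    have : (S.vert i, S.gen i) ∈ Set.range fun i => (S.vert i, S.gen i) := ⟨i, rfl⟩
    rw [h] at this
    exact this
  choose f hf using h1
  have hf1 : ∀ i, v (f i) = S.vert i := fun i => congrArg Prod.fst (hf i)
  have hf2 : ∀ i, g (f i) = S.gen i := fun i => congrArg Prod.snd (hf i)
  have hinj : Function.Injective f := fun i j hij =>
    S.sorted.injective (by rw [← hf2, ← hf2, hij])
  exact ⟨Equiv.ofBijective f (Finite.injective_iff_bijective.1 hinj),
    fun i => ⟨(hf1 i).symm, (hf2 i).symm⟩⟩

theorem GenSimplex.Lists.image_ne {n : ℕ} {S : GenSimplex n} {v : Fin (n + 1) → Pt n}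
    {g : ℕ → ℤ} {σ : Equiv.Perm (Fin (n + 1))} (h : S.Lists v g σ) (r : Fin (n + 1)) :
    (fun i => (S.vert i, S.gen i)) '' {i | i ≠ r} =
      (fun i : Fin (n + 1) => (v i, g i)) '' {i | i ≠ σ r} := by
  ext p
  constructor
  · rintro ⟨i, hi, rfl⟩
    exact ⟨σ i, fun e => hi (σ.injective e), Prod.ext (h i).1.symm (h i).2.symm⟩
  · rintro ⟨i, hi, rfl⟩
    refine ⟨σ.symm i, fun e => hi (by rw [← e, σ.apply_symm_apply]), ?_⟩
    have := h (σ.symm i)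
    rw [σ.apply_symm_apply] at this
    exact Prod.ext this.1 this.2

theorem GenSimplex.Lists.gen_symm {n : ℕ} {S : GenSimplex n} {v : Fin (n + 1) → Pt n}
    {g : ℕ → ℤ} {σ : Equiv.Perm (Fin (n + 1))} (h : S.Lists v g σ) (k : Fin (n + 1)) :
    S.gen (σ.symm k) = g k := by
  rw [(h _).2, σ.apply_symm_apply]

theorem GenSimplex.le_penult {n : ℕ} {k : Fin (n + 1)} (hk : k ≠ Fin.last n) :
    k ≤ penult n := by
  have : (k : ℕ) ≠ n := fun e => hk (Fin.ext e)
  show (k : ℕ) ≤ n - 1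
  omega

theorem GenSimplex.penult_ne_last {n : ℕ} (hn : 1 ≤ n) : penult n ≠ Fin.last n := by
  intro e
  have : n - 1 = n := congrArg Fin.val e
  omega

/-- The oldest vertex is the one with the smallest generation. -/
theorem GenSimplex.Lists.apply_last {n : ℕ} {S : GenSimplex n} {v : Fin (n + 1) → Pt n}
    {g : ℕ → ℤ} {σ : Equiv.Perm (Fin (n + 1))} (h : S.Lists v g σ) {k : Fin (n + 1)}
    (hk : ∀ i : Fin (n + 1), i ≠ k → g k < g i) : σ (Fin.last n) = k := by
  by_contra hne
  have h1 := hk _ hne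
  rw [← (h _).2, ← h.gen_symm] at h1
  exact absurd (S.sorted.lt_iff_gt.1 h1) (not_lt.2 (Fin.le_last _))

/-! ### The generation-based bisection edge in array positions -/

theorem FlatGen.edge_data {N n : ℕ} (hN : 1 ≤ N) {m : ℤ} {g : ℕ → ℤ} {S : GenSimplex n}
    {v : Fin (n + 1) → Pt n} {γ : Fin (n + 1)} (hγ : 1 ≤ (γ : ℕ))
    {σ : Equiv.Perm (Fin (n + 1))} (h : FlatGen N n γ (N * m) g) (hS : S.Lists v g σ) :
    σ (S.edgeIdx N) = 0 ∧ σ (Fin.last n) = γ ∧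
      S.newGen N = g γ + 2 * N + 1 - (g 0 - N * m) := by
  have hg0 := h.old 0 (by omega)
  have hgγ := h.old γ le_rfl
  have hlast : σ (Fin.last n) = γ := hS.apply_last fun i hi => by
    have hi' : (i : ℕ) ≠ γ := fun e => hi (Fin.ext e)
    have h1 := h.anti_old i γ
    have h2 := h.young i
    omega
  have glast : S.gen (Fin.last n) = g γ := by rw [(hS _).2, hlast]
  have g0 : S.gen (σ.symm 0) = g 0 := hS.gen_symm 0
  have lev0 : level N (g 0) = m + 1 := level_eq hN hg0.1 hg0.2
  have levγ : level N (g γ) = m + 1 := level_eq hN hgγ.1 hgγ.2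
  have hne : σ.symm 0 ≠ Fin.last n := by
    intro e
    rw [← e, σ.apply_symm_apply] at hlast
    rw [← hlast] at hγ
    simp at hγ
  -- In sorted order, the second oldest vertex lies between vertices `0` and `γ` of the array, which
  -- share a level.
  have hpen : level N (S.gen (GenSimplex.penult n)) = m + 1 := by
    have h1 := S.sorted.antitone (GenSimplex.le_penult hne)
    have h2 := S.sorted.antitone (Fin.le_last (GenSimplex.penult n))
    exact level_eq hN (by omega) (by omega)
  have hcond : ¬ level N (S.gen (Fin.last n)) ≠ level N (S.gen (GenSimplex.penult n)) := by
    rw [glast, levγ, hpen]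
    simp
  have hfirst : S.firstOld N = σ.symm 0 := by
    unfold GenSimplex.firstOld
    refine le_antisymm (Finset.min'_le _ _ ?_) (Finset.le_min' _ _ _ fun k hk => ?_)
    · rw [Finset.mem_filter, g0, glast, lev0, levγ]
      exact ⟨Finset.mem_univ _, rfl⟩
    · rw [Finset.mem_filter, glast, levγ, (hS k).2] at hk
      -- A vertex younger than array vertex `0` sits after position `γ`, so its level is higher.
      by_contra hlt
      have h1 := S.sorted (not_le.1 hlt)
      rw [g0, (hS k).2] at h1
      by_cases hσ : (σ k : ℕ) ≤ γ
      · have h2 := h.anti_old 0 (σ k)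
        rcases Nat.eq_zero_or_pos (σ k : ℕ) with e | e
        · rw [e] at h1
          omega
        · omega
      · have h2 := (h.young (σ k) (by omega) (by omega)).1
        have h3 := lt_level hN (g := g (σ k)) (m := m + 1) (by linarith)
        omega
  refine ⟨?_, hlast, ?_⟩
  · rw [GenSimplex.edgeIdx, if_neg hcond, hfirst, σ.apply_symm_apply]
  · rw [GenSimplex.newGen, if_neg hcond, hfirst, glast, g0, type_eq hN hg0.1 hg0.2]

theorem SpikedGen.edge_data {N n : ℕ} (hN : 1 ≤ N) {m : ℤ} {g : ℕ → ℤ} {S : GenSimplex n}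
    {v : Fin (n + 1) → Pt n} {γ : Fin (n + 1)} (hγ : 1 ≤ (γ : ℕ))
    {σ : Equiv.Perm (Fin (n + 1))} (h : SpikedGen N n γ (N * m) g) (hS : S.Lists v g σ) :
    σ (S.edgeIdx N) = γ ∧ σ (Fin.last n) = 0 ∧ S.newGen N = g γ + N := by
  have hg0 := h.zero
  have hgγ := h.old γ hγ le_rfl
  have hlast : σ (Fin.last n) = 0 := hS.apply_last fun i hi => by
    have hi' : (i : ℕ) ≠ 0 := fun e => hi (Fin.ext e)
    have h1 := h.old i
    have h2 := h.young i
    rw [Fin.val_zero]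
    omega
  have glast : S.gen (Fin.last n) = g 0 := by
    rw [(hS _).2, hlast]
    rfl
  have hγ' : σ.symm γ ≠ Fin.last n := by
    intro e
    rw [← e, σ.apply_symm_apply] at hlast
    rw [hlast] at hγ
    simp at hγ
  -- Every array vertex other than `0` and `γ` is younger than `γ`, and `0` already occupies the
  -- last sorted place.
  have hpen : σ (GenSimplex.penult n) = γ := by
    have h1 := S.sorted.antitone (GenSimplex.le_penult hγ')
    rw [hS.gen_symm, (hS _).2] at h1
    by_contra hne
    have hne' : (σ (GenSimplex.penult n) : ℕ) ≠ γ := fun e => hne (Fin.ext e)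
    have hne0 : (σ (GenSimplex.penult n) : ℕ) ≠ 0 := fun e =>
      GenSimplex.penult_ne_last (by omega) (σ.injective ((Fin.ext e).trans hlast.symm))
    have h2 := h.anti_old (σ (GenSimplex.penult n)) γ
    have h3 := h.young (σ (GenSimplex.penult n))
    omega
  have gpen : S.gen (GenSimplex.penult n) = g γ := by rw [(hS _).2, hpen]
  have hcond : level N (S.gen (Fin.last n)) ≠ level N (S.gen (GenSimplex.penult n)) := by
    rw [glast, gpen]
    have h1 := level_le hN hg0
    have h2 := lt_level hN hgγ.1
    omega
  refine ⟨?_, hlast, ?_⟩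
  · rw [GenSimplex.edgeIdx, if_pos hcond, hpen]
  · rw [GenSimplex.newGen, if_pos hcond, gpen]

/-- `S` and `M` have the same vertices, with generations that are admissible along the array
of `M`. -/
def Matches {n : ℕ} (N : ℕ) (S : GenSimplex n) (M : TaggedSimplex n) : Prop :=
  ∃ g x σ, AdmissibleGen N n M.tag g x ∧ S.Lists M.vert g σ

/-- The two patterns traverse the edge in opposite directions, which neither the segment nor its
midpoint detects. -/
theorem AdmissibleGen.edge_data {N n : ℕ} (hN : 1 ≤ N) {g : ℕ → ℤ} {x : ℤ} {S : GenSimplex n}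
    {v : Fin (n + 1) → Pt n} {γ : Fin (n + 1)} (hγ : 1 ≤ (γ : ℕ))
    {σ : Equiv.Perm (Fin (n + 1))} (h : AdmissibleGen N n γ g x) (hS : S.Lists v g σ) :
    (σ (S.edgeIdx N) = 0 ∧ σ (Fin.last n) = γ ∨ σ (S.edgeIdx N) = γ ∧ σ (Fin.last n) = 0) ∧
      S.newGen N = x := by
  obtain ⟨m, ⟨h, rfl⟩ | ⟨h, rfl⟩⟩ := h
  · obtain ⟨h1, h2, h3⟩ := h.edge_data hN hγ hS
    exact ⟨.inl ⟨h1, h2⟩, h3⟩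
  · obtain ⟨h1, h2, h3⟩ := h.edge_data hN hγ hS
    exact ⟨.inr ⟨h1, h2⟩, h3⟩

theorem Matches.body_eq {N n : ℕ} {S : GenSimplex n} {M : TaggedSimplex n}
    (h : Matches N S M) : S.body = M.body := by
  obtain ⟨g, x, σ, -, h⟩ := h
  have : S.vert = M.vert ∘ σ := funext fun i => (h i).1
  rw [GenSimplex.body, TaggedSimplex.body, this, σ.surjective.range_comp]

theorem Matches.edge_eq {N n : ℕ} (hN : 1 ≤ N) {S : GenSimplex n} {M : TaggedSimplex n}
    (h : Matches N S M) : S.edge N = M.edge := by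
  obtain ⟨g, x, σ, hg, h⟩ := h
  rw [GenSimplex.edge, TaggedSimplex.edge, (h _).1, (h (Fin.last n)).1]
  rcases (hg.edge_data hN M.tag_pos h).1 with ⟨h1, h2⟩ | ⟨h1, h2⟩
  · rw [h1, h2]
  · rw [h1, h2, segment_symm]

/-! ### Children as sets of vertices with generations -/

theorem TaggedSimplex.range_child₁ {n : ℕ} (M : TaggedSimplex n) (g : ℕ → ℤ) (x : ℤ) :
    Set.range (fun i : Fin (n + 1) => (M.child₁.vert i, childGen₁ M.tag g x i)) =
      insert (M.newVert, x) ((fun i : Fin (n + 1) => (M.vert i, g i)) '' {i | i ≠ M.tag}) := by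
  have hval : ∀ i, (M.child₁.vert i, childGen₁ M.tag g x i) =
      if i = M.tag then (M.newVert, x) else (M.vert i, g i) := fun i => by
    by_cases hi : i = M.tag
    · simp [child₁, childGen₁, hi]
    · simp [child₁, childGen₁, hi, Fin.val_inj]
  simp only [hval]
  ext p
  constructor
  · rintro ⟨i, rfl⟩
    by_cases hi : i = M.tag
    · exact .inl (if_pos hi)
    · exact .inr ⟨i, hi, (if_neg hi).symm⟩
  · rintro (rfl | ⟨i, hi, rfl⟩)
    · exact ⟨M.tag, if_pos rfl⟩
    · exact ⟨i, if_neg hi⟩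

theorem TaggedSimplex.range_child₂ {n : ℕ} (M : TaggedSimplex n) (g : ℕ → ℤ) (x : ℤ) :
    Set.range (fun i : Fin (n + 1) => (M.child₂.vert i, childGen₂ M.tag g x i)) =
      insert (M.newVert, x) ((fun i : Fin (n + 1) => (M.vert i, g i)) '' {i | i ≠ 0}) := by
  have hlt : ∀ (i : Fin (n + 1)) (hi : i < M.tag),
      (M.child₂.vert i, childGen₂ M.tag g x i) = (M.vert ⟨i + 1, by omega⟩, g (i + 1)) :=
    fun i hi => by simp [child₂, childGen₂, hi]
  have heq : (M.child₂.vert M.tag, childGen₂ M.tag g x M.tag) = (M.newVert, x) := by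
    simp [child₂, childGen₂]
  have hgt : ∀ i, M.tag < i →
      (M.child₂.vert i, childGen₂ M.tag g x i) = (M.vert i, g i) := fun i hi => by
    simp [child₂, childGen₂, hi.ne', hi.not_gt, Fin.val_inj]
  have htag := M.tag_pos
  ext p
  constructor
  · rintro ⟨i, rfl⟩
    rcases lt_trichotomy i M.tag with hi | rfl | hi
    · exact .inr ⟨⟨i + 1, by omega⟩, fun e => by simpa using congrArg Fin.val e,
        (hlt i hi).symm⟩
    · exact .inl heq
    · exact .inr ⟨i, fun e => by simp [e] at hi, (hgt i hi).symm⟩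
  · rintro (rfl | ⟨i, hi, rfl⟩)
    · exact ⟨M.tag, heq⟩
    · have hi0 : (i : ℕ) ≠ 0 := fun e => hi (Fin.ext e)
      rcases le_or_gt i M.tag with hle | hi'
      · have hle' : (i : ℕ) ≤ M.tag := hle
        refine ⟨⟨i - 1, by omega⟩, (hlt ⟨i - 1, by omega⟩ (Fin.lt_def.2 ?_)).trans ?_⟩
        · show (i : ℕ) - 1 < M.tag
          omega
        · have e : (i : ℕ) - 1 + 1 = i := by omega
          simp only [e]
      · exact ⟨i, hgt i hi'⟩

theorem TaggedSimplex.newTag_val {n : ℕ} (M : TaggedSimplex n) :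
    (M.newTag : ℕ) = nextTag n M.tag := by
  unfold newTag nextTag
  split_ifs <;> rfl

/-- If the vertices of `M'` with admissible generations form the set `A`, then there is a
`GenSimplex` with the same vertices and generations, and any such matches `M'`. -/
theorem matches_of_range_eq {N n : ℕ} {M' : TaggedSimplex n} {g : ℕ → ℤ}
    {x : ℤ} (hg : AdmissibleGen N n M'.tag g x) {A : Set (Pt n × ℤ)}
    (hA : Set.range (fun i : Fin (n + 1) => (M'.vert i, g i)) = A) :
    (∃ S' : GenSimplex n, Set.range (fun i => (S'.vert i, S'.gen i)) = A) ∧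
      ∀ S' : GenSimplex n, Set.range (fun i => (S'.vert i, S'.gen i)) = A → Matches N S' M' := by
  constructor
  · obtain ⟨S', σ, h⟩ := GenSimplex.exists_lists M'.vert g hg.injective
    exact ⟨S', h.range_eq.trans hA⟩
  · intro S' hS'
    obtain ⟨σ, h⟩ := GenSimplex.lists_of_range_eq (hS'.trans hA.symm)
    exact ⟨g, x, σ, hg, h⟩

/-- Both routines insert the same vertex with the same generation and discard array vertex `γ` or
`0`. Existence for each Maubach child serves one inclusion of the theorem, exhaustion of all
generation-based children the other. -/
theorem Matches.child {N n : ℕ} (hN : 1 ≤ N) {S : GenSimplex n} {M : TaggedSimplex n}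
    (h : Matches N S M) :
    (∃ S', GenSimplex.IsChild N S S' ∧ Matches N S' M.child₁) ∧
      (∃ S', GenSimplex.IsChild N S S' ∧ Matches N S' M.child₂) ∧
      ∀ S', GenSimplex.IsChild N S S' → Matches N S' M.child₁ ∨ Matches N S' M.child₂ := by
  obtain ⟨g, x, σ, hg, hS⟩ := h
  obtain ⟨he, hx⟩ := hg.edge_data hN M.tag_pos hS
  obtain ⟨⟨y₁, hg₁⟩, ⟨y₂, hg₂⟩⟩ := hg.child M.tag_pos
  rw [← M.newTag_val] at hg₁ hg₂
  have hv : S.newVert N = M.newVert := by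
    rw [GenSimplex.newVert, TaggedSimplex.newVert, (hS _).1, (hS (Fin.last n)).1]
    rcases he with ⟨h1, h2⟩ | ⟨h1, h2⟩
    · rw [h1, h2]
    · rw [h1, h2, midpoint_comm]
  have hr : ∀ r, (r = S.edgeIdx N ∨ r = Fin.last n) ↔ (σ r = M.tag ∨ σ r = 0) := fun r => by
    rw [← σ.injective.eq_iff, ← σ.injective.eq_iff (a := r) (b := Fin.last n)]
    rcases he with ⟨h1, h2⟩ | ⟨h1, h2⟩ <;> rw [h1, h2]
    exact or_comm
  have hchild : ∀ S', GenSimplex.IsChild N S S' ↔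
      ∃ k, (k = M.tag ∨ k = 0) ∧ Set.range (fun i => (S'.vert i, S'.gen i)) =
        insert (M.newVert, x) ((fun i : Fin (n + 1) => (M.vert i, g i)) '' {i | i ≠ k}) := by
    intro S'
    unfold GenSimplex.IsChild
    simp only [hr, hS.image_ne, hv, hx]
    -- The discarded index is transported from sorted order to array order.
    exact σ.surjective.exists (p := fun k => (k = M.tag ∨ k = 0) ∧ _ = insert _ (_ '' {i | i ≠ k}))
      |>.symm
  obtain ⟨⟨S₁, hS₁⟩, hall₁⟩ :=
    matches_of_range_eq (M' := M.child₁) hg₁ (M.range_child₁ g x)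
  obtain ⟨⟨S₂, hS₂⟩, hall₂⟩ :=
    matches_of_range_eq (M' := M.child₂) hg₂ (M.range_child₂ g x)
  refine ⟨⟨S₁, (hchild S₁).2 ⟨_, .inl rfl, hS₁⟩, hall₁ S₁ hS₁⟩,
    ⟨S₂, (hchild S₂).2 ⟨_, .inr rfl, hS₂⟩, hall₂ S₂ hS₂⟩, fun S' hS' => ?_⟩
  obtain ⟨k, rfl | rfl, hk⟩ := (hchild S').1 hS'
  · exact .inl (hall₁ S' hk)
  · exact .inr (hall₂ S' hk)

/-! ### The initial simplices -/

/-- Colors below `N` have generations in `(-N, 0]`, the band for `m = -1`. Only color `N` falls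
below it, so its presence decides between the spiked and the flat pattern; with tag `n` there are no
young vertices. -/
theorem matches_initial {N n : ℕ} {c : Pt n → Fin (N + 1)}
    {S : GenSimplex n} (hS : ∀ i, S.gen i = -((c (S.vert i) : ℕ) : ℤ)) {M : TaggedSimplex n}
    (htag : M.tag = Fin.last n)
    (hM : M.vert = if c (S.vert (Fin.last n)) = Fin.last N then
        Fin.cons (S.vert (Fin.last n)) (fun i : Fin n => S.vert i.castSucc)
      else S.vert) : Matches N S M := by
  have hval : ∀ i, (c (S.vert i) : ℕ) ≤ N := fun i => Nat.lt_succ_iff.1 (c (S.vert i)).isLt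
  have hmono : ∀ i j : Fin (n + 1), i < j → (c (S.vert i) : ℕ) < c (S.vert j) := fun i j hij => by
    have := S.sorted hij
    rw [hS, hS] at this
    omega
  have e : (N : ℤ) * (-1) = -N := by ring
  have htag' : (M.tag : ℕ) = n := by rw [htag, Fin.val_last]
  split_ifs at hM with hc
  · have hc' : (c (S.vert (Fin.last n)) : ℕ) = N := by rw [hc, Fin.val_last]
    -- The default `-N` matters at `k = 0`: it is the generation of the spike, which has color `N`.
    let g : ℕ → ℤ := fun k => if h : 1 ≤ k ∧ k ≤ n then S.gen ⟨k - 1, by omega⟩ else -N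
    have g0 : g 0 = -N := by simp [g]
    have gpos : ∀ k (h : 1 ≤ k ∧ k ≤ n), g k = S.gen ⟨k - 1, by omega⟩ := fun k h => dif_pos h
    refine ⟨g, _, finRotate (n + 1), ⟨-1, .inr ⟨?_, rfl⟩⟩, fun i => ?_⟩
    · rw [e, htag']
      refine ⟨g0.le, fun i hi hin => ?_, fun i j hi hij hj => ?_, fun i _ _ => by omega,
        fun i j _ _ _ => by omega⟩
      · rw [gpos i ⟨hi, hin⟩, hS]
        have := hmono ⟨i - 1, by omega⟩ (Fin.last n) (Fin.lt_def.2 (by simp; omega))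
        omega
      · rw [gpos i ⟨hi, by omega⟩, gpos j ⟨by omega, hj⟩]
        exact S.sorted (Fin.lt_def.2 (by simp; omega))
    · rw [hM]
      induction i using Fin.lastCases with
      | last =>
        rw [finRotate_last]
        exact ⟨rfl, by rw [hS, hc', Fin.val_zero, g0]⟩
      | cast i =>
        have hi : finRotate (n + 1) i.castSucc = i.succ := by
          rw [finRotate_apply, Fin.coeSucc_eq_succ]
        rw [hi, Fin.cons_succ, Fin.val_succ, gpos _ ⟨by omega, by omega⟩]
        exact ⟨rfl, rfl⟩
  · have hc' : (c (S.vert (Fin.last n)) : ℕ) < N :=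
      lt_of_le_of_ne (hval _) fun h => hc (Fin.ext h)
    -- Here the default value lies outside the array and is irrelevant.
    let g : ℕ → ℤ := fun k => if h : k ≤ n then S.gen ⟨k, by omega⟩ else 0
    have gle : ∀ k (h : k ≤ n), g k = S.gen ⟨k, by omega⟩ := fun k h => dif_pos h
    refine ⟨g, _, Equiv.refl _, ⟨-1, .inl ⟨?_, rfl⟩⟩, fun i => ?_⟩
    · rw [e, htag']
      refine ⟨fun i hi => ?_, fun i j hij hj => ?_, fun i _ _ => by omega,
        fun i j _ _ _ => by omega⟩
      · have h1 := S.sorted.antitone (Fin.le_last ⟨i, by omega⟩)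
        rw [hS, hS] at h1
        rw [gle i hi, hS]
        omega
      · rw [gle i (by omega), gle j hj]
        exact S.sorted (Fin.lt_def.2 hij)
    · rw [hM]
      exact ⟨rfl, (gle i (by omega)).symm⟩

theorem exists_matches_of_gen_initial {N n : ℕ} (hn : 1 ≤ n) {c : Pt n → Fin (N + 1)}
    {T : Set (Pt n)} {S : GenSimplex n} (hS : S.IsInitial c T) :
    ∃ M : TaggedSimplex n, M.IsInitial c T ∧ Matches N S M := by
  refine ⟨⟨_, Fin.last n, hn⟩, ⟨S.vert, hS.1, fun i j hij => ?_, rfl, rfl⟩,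
    matches_initial hS.2 rfl rfl⟩
  have := S.sorted hij
  rw [hS.2, hS.2] at this
  show (c (S.vert i) : ℕ) < c (S.vert j)
  omega

theorem exists_matches_of_tagged_initial {N n : ℕ} {c : Pt n → Fin (N + 1)}
    {T : Set (Pt n)} {M : TaggedSimplex n} (hM : M.IsInitial c T) :
    ∃ S : GenSimplex n, S.IsInitial c T ∧ Matches N S M := by
  obtain ⟨v, hv, hmono, htag, hvert⟩ := hM
  refine ⟨⟨v, fun i => -((c (v i) : ℕ) : ℤ), fun i j hij => ?_⟩, ⟨hv, fun i => rfl⟩,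
    matches_initial (fun i => rfl) htag hvert⟩
  have : (c (v i) : ℕ) < c (v j) := hmono hij
  simp only
  omega

/-! ### The two routines produce matching simplices -/

theorem exists_matches_of_gen_descendant {N n : ℕ} (hn : 1 ≤ n) (hN : 1 ≤ N)
    {c : Pt n → Fin (N + 1)} {T : Set (Pt n)} {k : ℕ} {S : GenSimplex n}
    (h : GenSimplex.Descendant c T k S) :
    ∃ M, TaggedSimplex.Descendant c T k M ∧ Matches N S M := by
  induction h with
  | initial h =>
    obtain ⟨M, hM, hSM⟩ := exists_matches_of_gen_initial hn h
    exact ⟨M, .initial hM, hSM⟩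
  | bisect _ h' ih =>
    obtain ⟨M, hM, hSM⟩ := ih
    rcases (hSM.child hN).2.2 _ h' with h | h
    · exact ⟨_, .bisect₁ hM, h⟩
    · exact ⟨_, .bisect₂ hM, h⟩

theorem exists_matches_of_tagged_descendant {N n : ℕ} (hN : 1 ≤ N)
    {c : Pt n → Fin (N + 1)} {T : Set (Pt n)} {k : ℕ} {M : TaggedSimplex n}
    (h : TaggedSimplex.Descendant c T k M) :
    ∃ S, GenSimplex.Descendant c T k S ∧ Matches N S M := by
  induction h with
  | initial h =>
    obtain ⟨S, hS, hSM⟩ := exists_matches_of_tagged_initial h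
    exact ⟨S, .initial hS, hSM⟩
  | bisect₁ _ ih =>
    obtain ⟨S, hS, hSM⟩ := ih
    obtain ⟨S', h1, h2⟩ := (hSM.child hN).1
    exact ⟨S', .bisect hS h1, h2⟩
  | bisect₂ _ ih =>
    obtain ⟨S, hS, hSM⟩ := ih
    obtain ⟨S', h1, h2⟩ := (hSM.child hN).2.1
    exact ⟨S', .bisect hS h1, h2⟩

theorem genSimplices_eq_maubachSimplices {N n : ℕ} (hn : 1 ≤ n) (hN : 1 ≤ N)
    (c : Pt n → Fin (N + 1)) (T : Set (Pt n)) (k : ℕ) :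
    genSimplices c T k = maubachSimplices c T k := by
  ext B
  constructor
  · rintro ⟨S, hS, rfl⟩
    obtain ⟨M, hM, h⟩ := exists_matches_of_gen_descendant hn hN hS
    exact ⟨M, hM, h.body_eq⟩
  · rintro ⟨M, hM, rfl⟩
    obtain ⟨S, hS, h⟩ := exists_matches_of_tagged_descendant hN hM
    exact ⟨S, hS, h.body_eq.symm⟩

theorem genEdges_eq_maubachEdges {N n : ℕ} (hn : 1 ≤ n) (hN : 1 ≤ N)
    (c : Pt n → Fin (N + 1)) (T : Set (Pt n)) (k : ℕ) :
    genEdges c T k = maubachEdges c T k := by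
  ext p
  constructor
  · rintro ⟨S, hS, rfl⟩
    obtain ⟨M, hM, h⟩ := exists_matches_of_gen_descendant hn hN hS
    exact ⟨M, hM, by rw [h.body_eq, h.edge_eq hN]⟩
  · rintro ⟨M, hM, rfl⟩
    obtain ⟨S, hS, h⟩ := exists_matches_of_tagged_descendant hN hM
    exact ⟨S, hS, by rw [h.body_eq, h.edge_eq hN]⟩

end ColoredBisection

theorem mainTheorem3 (n N : ℕ) (hn : 1 ≤ n)
    (𝒯 : Set (Set (ColoredBisection.Pt n))) (c : ColoredBisection.Pt n → Fin (N + 1))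
    (hc : ColoredBisection.IsColored n N 𝒯 c) :
    ColoredBisection.genTree c 𝒯 = ColoredBisection.maubachTree c 𝒯 ∧
    ∀ T ∈ 𝒯, ∀ k : ℕ,
      ColoredBisection.genSimplices c T k = ColoredBisection.maubachSimplices c T k ∧
      ColoredBisection.genEdges c T k = ColoredBisection.maubachEdges c T k := by
  have hN : 1 ≤ N := hn.trans hc.le
  refine ⟨?_, fun T _ k => ⟨ColoredBisection.genSimplices_eq_maubachSimplices hn hN c T k,
    ColoredBisection.genEdges_eq_maubachEdges hn hN c T k⟩⟩
  unfold ColoredBisection.genTree ColoredBisection.maubachTree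
  simp only [ColoredBisection.genSimplices_eq_maubachSimplices hn hN]
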